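/- All graphs are finite and simple. For $d\in\mathbb N=\{0,1,2,\dots\}$, the $d$th power $G^d$ of a graph $G$ has the same vertex set as $G$, two distinct vertices being adjacent in $G^d$ if and only if their distance in $G$ is at most $d$; for a class of graphs $\mathcal C$ put $\mathcal C^d=\{G^d : G\in\mathcal C\}$. A graph $H$ is a depth-$r$ minor of $G$ if it can be obtained from a subgraph of $G$ by contracting pairwise disjoint connected subgraphs of radius at most $r$; $\nabla_r(G)$ is the maximum of $|E(H)|/|V(H)|$ over the depth-$r$ minors $H$ of $G$ (the ratio is read as $0$ for the graph without vertices). A class $\mathcal C$ has bounded expansion if $\sup_{G\in\mathcal C}\nabla_r(G)<\infty$ for every $r\in\mathbb N$. A clustering of a graph $H$ is a partition $\mathcal X$ of $V(H)$ into non-empty blocks each of which is a clique in $H$; the quotient graph $H/\mathcal X$ has the blocks of $\mathcal X$ as its vertices, two distinct blocks $A,B$ being adjacent if and only if some $u\in A$ and $v\in B$ are adjacent in $H$. Let $\mathcal C$ be a class of graphs with bounded expansion and let $d\in\mathbb N$. Then one can choose for every graph $H\in\mathcal C^d$ a clustering $\mathcal X_H$ of $H$ such that the class $\{H/\mathcal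 X_H : H\in\mathcal C^d\}$ also has bounded expansion. -/

import Mathlib

open scoped ENNReal

universe u

/-- A finite simple graph together with its vertex set. -/
structure FinGraph : Type (u + 1) where
  V : Type u
  [finite : Finite V]
  graph : SimpleGraph V

attribute [instance] FinGraph.finite

namespace FinGraph

/-- The `d`th power of `G`: distinct vertices are adjacent iff their distance in `G` is at most `d`
(the distance is `⊤` between different components). -/
def powerGraph {V : Type u} (G : SimpleGraph V) (d : ℕ) : SimpleGraph V where
  Adj x y := x ≠ y ∧ G.edist x y ≤ d
  symm := ⟨fun x y h => ⟨h.1.symm, by rw [SimpleGraph.edist_comm]; exact h.2⟩⟩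
  loopless := ⟨fun _ h => h.1 rfl⟩

/-- The `d`th power of `G`, as a finite graph. -/
def power (G : FinGraph.{u}) (d : ℕ) : FinGraph.{u} where
  V := G.V
  graph := powerGraph G.graph d

/-- The class of `d`th powers of the graphs of a class. -/
def powerClass (C : Set FinGraph.{u}) (d : ℕ) : Set FinGraph.{u} :=
  (fun G => G.power d) '' C

/-- `H` is a depth-`r` minor of `G`: the vertices of `H` are represented by pairwise disjoint
connected subgraphs of `G` of radius at most `r`, and any two vertices adjacent in `H` are
represented by subgraphs joined by an edge of `G`. -/
def IsDepthMinor (r : ℕ) (H G : FinGraph.{u}) : Prop :=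
  ∃ branch : H.V → G.graph.Subgraph,
    (∀ a, (branch a).coe.Connected ∧ (branch a).coe.radius ≤ r) ∧
    (∀ a b, a ≠ b → Disjoint (branch a).verts (branch b).verts) ∧
    (∀ a b, H.graph.Adj a b →
      ∃ x ∈ (branch a).verts, ∃ y ∈ (branch b).verts, G.graph.Adj x y)

/-- Number of edges divided by number of vertices; the value is `0` for the graph without
vertices. -/
noncomputable def edgeDensity (H : FinGraph.{u}) : ℝ≥0∞ :=
  (H.graph.edgeSet.ncard : ℝ≥0∞) / (Nat.card H.V : ℝ≥0∞)

/-- `∇_r(G)`: the largest edge density of a depth-`r` minor of `G`. -/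
noncomputable def nabla (r : ℕ) (G : FinGraph.{u}) : ℝ≥0∞ :=
  ⨆ (H : FinGraph.{u}) (_ : IsDepthMinor r H G), H.edgeDensity

/-- A class of graphs has bounded expansion if `sup_{G ∈ C} ∇_r(G)` is finite for every `r`. -/
def BoundedExpansion (C : Set FinGraph.{u}) : Prop :=
  ∀ r : ℕ, (⨆ G ∈ C, nabla r G) < ⊤

/-- A partition of the vertex set of `H` into cliques. -/
structure Clustering {V : Type u} (H : SimpleGraph V) where
  blocks : Set (Set V)
  isPartition : Setoid.IsPartition blocks
  isClique : ∀ A ∈ blocks, H.IsClique A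

/-- The quotient graph: its vertices are the blocks, and two different blocks are adjacent iff
some edge of `H` joins them. -/
def Clustering.quotientGraph {V : Type u} {H : SimpleGraph V} (X : Clustering H) :
    SimpleGraph X.blocks where
  Adj A B := A ≠ B ∧ ∃ x ∈ A.1, ∃ y ∈ B.1, H.Adj x y
  symm := ⟨fun _ _ ⟨hne, x, hx, y, hy, h⟩ => ⟨hne.symm, y, hy, x, hx, h.symm⟩⟩
  loopless := ⟨fun _ h => h.1 rfl⟩

/-- The quotient graph of a finite graph, as a finite graph. -/
def quotient (H : FinGraph.{u}) (X : Clustering H.graph) : FinGraph.{u} where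
  V := X.blocks
  graph := X.quotientGraph

end FinGraph

/-! Bounded expansion enters through bounded weak colouring numbers: for each radius, every graph of
the class has a ranking in which each vertex weakly reaches boundedly many others
(`BoundedExpansion.exists_ranking`). This follows from `exists_hitting_set`: in any non-empty set
some vertex is separated from the rest, along short walks, by a bounded set. Removing such vertices
one by one gives the ranking.

Put `k = d / 2` and let `c x` be the vertex of least rank in the `k`-ball of `x`. The fibres of `c`
are cliques of the power, as `2 * k ≤ d`. Represent a fibre with centre `u` by the set of vertices
that weakly `2 * k`-reach `u`. These sets have radius at most `2 * k`, each vertex lies in boundedly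
many of them, and adjacent blocks have intersecting or touching sets, because a walk of length at
most `2 * k + 1` has a middle (`exists_clustering`).

So the quotient is a shallow minor of `G` up to bounded congestion. Given a shallow minor of it,
take the vertex of least rank in each branch set's union; for adjacent branch sets one of these
vertices weakly reaches the other, which bounds the number of edges (`nabla_le_of_congestion`). -/

namespace FinGraph

/-! ### Short walks inside a vertex set -/

section Reach

variable {V : Type u} {G : SimpleGraph V}

/-- `y` can be reached from `x` by a walk of length at most `n` that stays inside `A`. -/
def ReachIn (G : SimpleGraph V) (A : Set V) (n : ℕ) (x y : V) : Prop :=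
  ∃ p : G.Walk x y, p.length ≤ n ∧ ∀ z ∈ p.support, z ∈ A

theorem ReachIn.refl {A : Set V} {x : V} (hx : x ∈ A) (n : ℕ) : ReachIn G A n x x :=
  ⟨.nil, by simp, by simpa using hx⟩

theorem ReachIn.mono {A A' : Set V} {n n' : ℕ} {x y : V} (h : ReachIn G A n x y)
    (hA : A ⊆ A') (hn : n ≤ n') : ReachIn G A' n' x y := by
  obtain ⟨p, hp, hs⟩ := h
  exact ⟨p, hp.trans hn, fun z hz => hA (hs z hz)⟩

theorem ReachIn.symm {A : Set V} {n : ℕ} {x y : V} (h : ReachIn G A n x y) :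
    ReachIn G A n y x := by
  obtain ⟨p, hp, hs⟩ := h
  exact ⟨p.reverse, by simpa using hp, fun z hz => hs z (by simpa using hz)⟩

theorem ReachIn.trans {A : Set V} {m n : ℕ} {x y z : V} (h : ReachIn G A m x y)
    (h' : ReachIn G A n y z) : ReachIn G A (m + n) x z := by
  obtain ⟨p, hp, hs⟩ := h
  obtain ⟨q, hq, hs'⟩ := h'
  refine ⟨p.append q, by rw [SimpleGraph.Walk.length_append]; omega, fun w hw => ?_⟩
  rcases (SimpleGraph.Walk.mem_support_append_iff p q).1 hw with h | h
  exacts [hs w h, hs' w h]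

theorem ReachIn.of_adj {A : Set V} {x y : V} (h : G.Adj x y) (hx : x ∈ A) (hy : y ∈ A) :
    ReachIn G A 1 x y :=
  ⟨h.toWalk, by simp, by simp [hx, hy]⟩

theorem ReachIn.left_mem {A : Set V} {n : ℕ} {x y : V} (h : ReachIn G A n x y) : x ∈ A := by
  obtain ⟨p, -, hs⟩ := h
  exact hs x p.start_mem_support

theorem ReachIn.right_mem {A : Set V} {n : ℕ} {x y : V} (h : ReachIn G A n x y) : y ∈ A :=
  h.symm.left_mem

/-- The vertices of a walk inside `A` that ends in `y` can themselves reach `y` inside `A`. -/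
theorem ReachIn.inside_basin {A : Set V} {n : ℕ} {x y : V} (h : ReachIn G A n x y) :
    ReachIn G {z | ReachIn G A n z y} n x y := by
  classical
  obtain ⟨p, hp, hs⟩ := h
  refine ⟨p, hp, fun z hz => ⟨p.dropUntil z hz, ?_, fun w hw => ?_⟩⟩
  · exact (p.length_dropUntil_le_length hz).trans hp
  · exact hs w (p.support_dropUntil_subset_support hz hw)

/-- A walk that starts in `A` and ends outside leaves `A` for a first time. -/
theorem exists_first_exit {A : Set V} {x y : V} (p : G.Walk x y) (hx : x ∈ A) (hy : y ∉ A) :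
    ∃ n u w, n + 1 ≤ p.length ∧ ReachIn G A n x u ∧ G.Adj u w ∧ w ∉ A ∧ w ∈ p.support := by
  induction p with
  | nil => exact absurd hx hy
  | @cons a b c hab q ih =>
    by_cases hb : b ∈ A
    · obtain ⟨n, u, w, hn, hr, huw, hw, hws⟩ := ih hb hy
      refine ⟨n + 1, u, w, by simpa using hn, ?_, huw, hw, by simp [hws]⟩
      exact ((ReachIn.of_adj hab hx hb).trans hr).mono subset_rfl (by omega)
    · exact ⟨0, a, b, by simp, .refl hx 0, hab, hb, by simp⟩

end Reach

/-! ### Ball models and independent sets of low degree -/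

section Sparse

variable {V : Type u} {G : SimpleGraph V}

/-- The sets `A` and `B` are joined by an edge of `G`. -/
def Touch (G : SimpleGraph V) (A B : Set V) : Prop := ∃ x ∈ A, ∃ y ∈ B, G.Adj x y

theorem Touch.symm {A B : Set V} (h : Touch G A B) : Touch G B A := by
  obtain ⟨x, hx, y, hy, h⟩ := h
  exact ⟨y, hy, x, hx, h.symm⟩

theorem Touch.mono {A B A' B' : Set V} (h : Touch G A B) (hA : A ⊆ A') (hB : B ⊆ B') :
    Touch G A' B' := by
  obtain ⟨x, hx, y, hy, h⟩ := h
  exact ⟨x, hA hx, y, hB hy, h⟩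

/-- Pairwise disjoint sets `B v ∋ v`, for `v ∈ J`, each spanned by walks of length at most `ρ`
from `v`. -/
structure IsBallModel (G : SimpleGraph V) (ρ : ℕ) (J : Finset V) (B : V → Set V) : Prop where
  mem : ∀ v ∈ J, v ∈ B v
  disj : ∀ u ∈ J, ∀ v ∈ J, u ≠ v → Disjoint (B u) (B v)
  reach : ∀ v ∈ J, ∀ x ∈ B v, ReachIn G (B v) ρ v x

open Classical in
/-- The ordered pairs of distinct members of `J` whose sets touch. -/
noncomputable def touchPairs (G : SimpleGraph V) (J : Finset V) (B : V → Set V) :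
    Finset (V × V) :=
  (J ×ˢ J).filter fun p => p.1 ≠ p.2 ∧ Touch G (B p.1) (B p.2)

theorem mem_touchPairs {J : Finset V} {B : V → Set V} {u v : V} :
    (u, v) ∈ touchPairs G J B ↔ (u ∈ J ∧ v ∈ J) ∧ u ≠ v ∧ Touch G (B u) (B v) := by
  simp [touchPairs]

/-- The touching graphs of ball models of radius `ρ` have average degree at most `c`. -/
def SparseAt (G : SimpleGraph V) (ρ c : ℕ) : Prop :=
  ∀ (J : Finset V) (B : V → Set V), IsBallModel G ρ J B → (touchPairs G J B).card ≤ c * J.card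

/-- A graph of bounded average degree has a large independent set of vertices of low degree. -/
theorem exists_independent_low_degree {V : Type u} [DecidableEq V] (S : Finset V)
    (P : Finset (V × V)) (hsymm : ∀ u v, (u, v) ∈ P → (v, u) ∈ P) (c : ℕ)
    (hP : P.card ≤ c * S.card) :
    ∃ I ⊆ S, (∀ u ∈ I, ∀ v ∈ I, u ≠ v → (u, v) ∉ P) ∧
      (∀ v ∈ I, (S.filter fun u => (v, u) ∈ P).card ≤ 2 * c) ∧
      S.card ≤ 2 * (2 * c + 1) * I.card := by
  classical
  set deg : V → ℕ := fun v => (S.filter fun u => (v, u) ∈ P).card with hdeg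
  set L := S.filter fun v => deg v ≤ 2 * c with hL
  have hsum : ∑ v ∈ S, deg v ≤ P.card := by
    rw [← Finset.card_sigma]
    refine Finset.card_le_card_of_injOn (fun x => (x.1, x.2)) ?_ ?_
    · rintro ⟨a, b⟩ h
      simp at h
      exact h.2.2
    · rintro ⟨a, b⟩ _ ⟨a', b'⟩ _ h
      simp at h
      simp [h.1, h.2]
  -- Markov's inequality: fewer than half of a non-empty `S` can exceed twice the average bound `c`.
  have hhigh : (S.filter fun v => ¬ deg v ≤ 2 * c).card * (2 * c + 1) ≤ c * S.card := by
    refine le_trans ?_ (hsum.trans hP)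
    refine le_trans ?_ (Finset.sum_le_sum_of_subset
      (Finset.filter_subset (fun v => ¬ deg v ≤ 2 * c) S))
    rw [← smul_eq_mul]
    refine Finset.card_nsmul_le_sum _ _ _ fun v hv => ?_
    have := (Finset.mem_filter.1 hv).2
    omega
  have hcard : L.card + (S.filter fun v => ¬ deg v ≤ 2 * c).card = S.card :=
    Finset.card_filter_add_card_filter_not _
  have hSL : S.card ≤ 2 * L.card := by nlinarith
  let F := L.powerset.filter fun I => ∀ u ∈ I, ∀ v ∈ I, u ≠ v → (u, v) ∉ P
  obtain ⟨I, hIF, hmax⟩ := F.exists_max_image Finset.card ⟨∅, by simp [F]⟩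
  obtain ⟨hIL, hind⟩ : I ⊆ L ∧ ∀ u ∈ I, ∀ v ∈ I, u ≠ v → (u, v) ∉ P := by
    simpa [F] using hIF
  -- A largest independent subset of `L` dominates `L`, and closed neighbourhoods have at most `2 *
  -- c + 1` elements.
  have hcover : L ⊆ I.biUnion fun v => insert v (S.filter fun u => (v, u) ∈ P) := by
    intro x hx
    by_contra hcon
    simp only [Finset.mem_biUnion, Finset.mem_insert, Finset.mem_filter, not_exists, not_and,
      not_or] at hcon
    have hxS : x ∈ S := (Finset.mem_filter.1 hx).1
    have hxI : x ∉ I := fun h => (hcon x h).1 rfl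
    have hnew : insert x I ∈ F := by
      simp only [F, Finset.mem_filter, Finset.mem_powerset]
      refine ⟨Finset.insert_subset hx hIL, fun u hu v hv huv huvP => ?_⟩
      rw [Finset.mem_insert] at hu hv
      rcases hu with rfl | hu <;> rcases hv with rfl | hv
      · exact huv rfl
      · exact (hcon v hv).2 hxS (hsymm _ _ huvP)
      · exact (hcon u hu).2 hxS huvP
      · exact hind u hu v hv huv huvP
    have := hmax _ hnew
    rw [Finset.card_insert_of_notMem hxI] at this
    omega
  have hLI : L.card ≤ I.card * (2 * c + 1) := by
    refine (Finset.card_le_card hcover).trans (Finset.card_biUnion_le_card_mul _ _ _ fun v hv => ?_)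
    have := (Finset.mem_filter.1 (hIL hv)).2
    exact (Finset.card_insert_le _ _).trans (by simpa [hdeg] using this)
  refine ⟨I, hIL.trans (Finset.filter_subset _ _), hind,
    fun v hv => (Finset.mem_filter.1 (hIL hv)).2, ?_⟩
  nlinarith

end Sparse

/-! ### Small separators from saturated ball models -/

section Hitting

variable {V : Type u} {G : SimpleGraph V}

/-- The union of the sets of a ball model. -/
def modelUnion (S : Finset V) (B : V → Set V) : Set V := {x | ∃ v ∈ S, x ∈ B v}

/-- Enlarging one set of a ball model by a walk that avoids the model. -/
theorem IsBallModel.augment [DecidableEq V] [Finite V] {ρ : ℕ} {S : Finset V} {B : V → Set V}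
    (hB : IsBallModel G ρ S B) {u v y : V} (hu : u ∈ S) (hv : v ∈ S) (huv : u ≠ v)
    (hr : ReachIn G ((modelUnion S B)ᶜ ∪ {u}) ρ u y) (hyv : G.Adj y v) :
    ∃ B', IsBallModel G ρ S B' ∧ touchPairs G S B ⊆ touchPairs G S B' ∧
      (u, v) ∈ touchPairs G S B' ∧
      (modelUnion S B' \ S).ncard ≤ (modelUnion S B \ S).ncard + ρ := by
  obtain ⟨p, hp, hs⟩ := hr
  set B' := Function.update B u (B u ∪ {z | z ∈ p.support}) with hB'
  have hBu : B' u = B u ∪ {z | z ∈ p.support} := by simp [hB']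
  have hBw : ∀ w, w ≠ u → B' w = B w := fun w hw => by simp [hB', hw]
  have hle : ∀ w, B w ⊆ B' w := by
    intro w
    by_cases hw : w = u
    · subst hw; rw [hBu]; exact Set.subset_union_left
    · rw [hBw w hw]
  have hdisj : ∀ w ∈ S, w ≠ u → Disjoint (B' u) (B w) := by
    intro w hw hwu
    rw [hBu, Set.disjoint_union_left]
    refine ⟨hB.disj u hu w hw hwu.symm, Set.disjoint_left.2 fun z hz hzw => ?_⟩
    rcases hs z hz with h | h
    · exact h ⟨w, hw, hzw⟩
    · rw [Set.mem_singleton_iff] at h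
      subst h
      exact Set.disjoint_left.1 (hB.disj z hu w hw hwu.symm) (hB.mem z hu) hzw
  refine ⟨B', ⟨fun w hw => hle w (hB.mem w hw), fun a ha b hb hab => ?_, fun w hw x hx => ?_⟩,
    ?_, ?_, ?_⟩
  · by_cases hau : a = u
    · subst hau; rw [hBw b hab.symm]; exact hdisj b hb hab.symm
    · rw [hBw a hau]
      by_cases hbu : b = u
      · subst hbu; exact (hdisj a ha hab).symm
      · rw [hBw b hbu]; exact hB.disj a ha b hb hab
  · by_cases hwu : w = u
    · subst hwu
      rw [hBu] at hx ⊢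
      rcases hx with hx | hx
      · exact (hB.reach w hw x hx).mono Set.subset_union_left le_rfl
      · exact ⟨p.takeUntil x hx, (p.length_takeUntil_le_length hx).trans hp,
          fun z hz => Or.inr (p.support_takeUntil_subset_support hx hz)⟩
    · rw [hBw w hwu] at hx ⊢
      exact hB.reach w hw x hx
  · rintro ⟨a, b⟩ hab
    rw [mem_touchPairs] at hab ⊢
    exact ⟨hab.1, hab.2.1, hab.2.2.mono (hle a) (hle b)⟩
  · rw [mem_touchPairs]
    refine ⟨⟨hu, hv⟩, huv, y, ?_, v, hle v (hB.mem v hv), hyv⟩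
    rw [hBu]
    exact Or.inr p.end_mem_support
  -- The walk starts at `u ∈ S`, so only its tail can contribute new vertices: at most `ρ`, not `ρ +
  -- 1`.
  · have hsub : modelUnion S B' \ S ⊆ (modelUnion S B \ S) ∪ (p.support.tail.toFinset : Set V) := by
      rintro x ⟨⟨w, hw, hx⟩, hxS⟩
      by_cases hwu : w = u
      · subst hwu
        rw [hBu] at hx
        rcases hx with hx | hx
        · exact Or.inl ⟨⟨w, hw, hx⟩, hxS⟩
        · refine Or.inr ?_
          rw [Set.mem_ofPred_eq, SimpleGraph.Walk.mem_support_iff] at hx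
          rcases hx with rfl | hx
          · exact absurd hw hxS
          · simpa using hx
      · rw [hBw w hwu] at hx
        exact Or.inl ⟨⟨w, hw, hx⟩, hxS⟩
    refine (Set.ncard_le_ncard hsub (Set.toFinite _)).trans ((Set.ncard_union_le _ _).trans ?_)
    rw [Set.ncard_coe_finset]
    have h1 := List.toFinset_card_le p.support.tail
    have h2 : p.support.tail.length = p.length := by simp
    omega

/-- A ball model on `S` that is small and cannot be enlarged so as to create a new touching
pair. -/
theorem exists_saturated_model [Finite V] (G : SimpleGraph V) (ρ : ℕ) (S : Finset V) :
    ∃ B, IsBallModel G ρ S B ∧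
      (modelUnion S B \ S).ncard ≤ ρ * (touchPairs G S B).card ∧
      ∀ u ∈ S, ∀ v ∈ S, u ≠ v → ∀ y, ReachIn G ((modelUnion S B)ᶜ ∪ {u}) ρ u y → G.Adj y v →
        (u, v) ∈ touchPairs G S B := by
  classical
  -- An augmentation gains at least one pair and at most `ρ` vertices outside `S`, so it preserves
  -- this size bound; a good model with the most pairs is therefore saturated.
  let Good : Set (V → Set V) := {B | IsBallModel G ρ S B ∧
    (modelUnion S B \ S).ncard ≤ ρ * (touchPairs G S B).card}
  have hne : Good.Nonempty := by
    refine ⟨fun v => {v}, ⟨fun v _ => rfl, fun u _ v _ h => by simpa using h, ?_⟩, ?_⟩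
    · rintro v _ x rfl
      exact .refl (Set.mem_singleton _) _
    · have : modelUnion S (fun v => {v}) \ (S : Set V) = ∅ := by
        ext x
        simp [modelUnion]
      simp [this]
  obtain ⟨B, hB, hmax⟩ := Set.exists_max_image Good (fun B => (touchPairs G S B).card)
    (Set.toFinite _) hne
  refine ⟨B, hB.1, hB.2, fun u hu v hv huv y hr hyv => ?_⟩
  by_contra hnot
  obtain ⟨B', hB', hsub, hmem, hcard⟩ := hB.1.augment hu hv huv hr hyv
  have hlt : (touchPairs G S B).card < (touchPairs G S B').card :=
    Finset.card_lt_card ⟨hsub, fun h => hnot (h hmem)⟩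
  have hgood : B' ∈ Good := by
    refine ⟨hB', hcard.trans ?_⟩
    have := hB.2
    nlinarith
  exact absurd (hmax B' hgood) (not_le.2 hlt)

/-- The size of the hitting sets in terms of the radius and the sparsity. -/
def hitBound (r c : ℕ) : ℕ := 2 * c + c * (1 + 2 * r * c * (2 * (2 * c + 1)))

/-- In a sparse graph every non-empty set `S` contains a vertex that is separated from the rest of
`S`, with respect to short walks, by a small set. -/
theorem exists_hitting_set [Finite V] {r c : ℕ} (hG : SparseAt G (2 * r) c) {S : Finset V}
    (hS : S.Nonempty) :
    ∃ v ∈ S, ∃ Z : Finset V, v ∉ Z ∧ Z.card ≤ hitBound r c ∧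
      ∀ u ∈ S, u ≠ v → ∀ p : G.Walk v u, p.length ≤ r → ∃ z ∈ Z, z ∈ p.support := by
  classical
  have := Fintype.ofFinite V
  obtain ⟨B, hB, hsmall, hsat⟩ := exists_saturated_model G (2 * r) S
  set U := modelUnion S B with hU
  set P := touchPairs G S B with hP
  have hSU : ∀ v ∈ S, v ∈ U := fun v hv => ⟨v, hv, hB.mem v hv⟩
  have hPsymm : ∀ u v, (u, v) ∈ P → (v, u) ∈ P := by
    intro u v h
    rw [hP, mem_touchPairs] at h ⊢
    exact ⟨h.1.symm, h.2.1.symm, h.2.2.symm⟩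
  have hPc : P.card ≤ c * S.card := hG S B hB
  obtain ⟨I, hIS, hind, hlow, hbig⟩ := exists_independent_low_degree S P hPsymm c hPc
  set T : V → Set V := fun v => {x | ReachIn G (Uᶜ ∪ {v}) r v x} with hT
  set M : Finset V := (U \ S).toFinset with hM
  set Z : V → Finset V := fun v => Finset.univ.filter fun z =>
    z ∈ U ∧ z ≠ v ∧ ∃ x ∈ T v, G.Adj x z with hZ
  have hself : ∀ v, v ∈ T v := fun v =>
    ReachIn.refl (G := G) (A := Uᶜ ∪ {v}) (x := v) (Or.inr rfl) r
  have hTsub : ∀ v, T v ⊆ Uᶜ ∪ {v} := fun v x hx => ReachIn.right_mem hx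
  -- A common point would give a walk of length at most `2 * r` from `u` to `v` avoiding the rest of
  -- `U`; saturation at radius `2 * r` would then make the independent vertices `u` and `v` touch.
  have hTdisj : ∀ u ∈ I, ∀ v ∈ I, u ≠ v → Disjoint (T u) (T v) := by
    intro u hu v hv huv
    refine Set.disjoint_left.2 fun x hxu hxv => hind u hu v hv huv ?_
    obtain ⟨p, hp, hps⟩ : ReachIn G (Uᶜ ∪ {u} ∪ {v}) (r + r) u v :=
      (ReachIn.mono hxu Set.subset_union_left le_rfl).trans
        (ReachIn.mono (ReachIn.symm hxv) (by rintro z (h | h) <;> simp_all) le_rfl)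
    obtain ⟨n, y, w, hn, hr, hyw, hw, hwp⟩ := exists_first_exit p
      (show u ∈ Uᶜ ∪ {u} from Or.inr rfl)
      (show v ∉ Uᶜ ∪ {u} by
        rintro (h | h)
        · exact h (hSU v (hIS hv))
        · exact huv h.symm)
    obtain rfl : w = v := (hps w hwp).resolve_left hw
    exact hsat u (hIS hu) w (hIS hv) huv y (hr.mono subset_rfl (by omega)) hyw
  -- By saturation, separator vertices in `S` are touching neighbours of `v`, of which there are
  -- few.
  have hZS : ∀ v ∈ I, ((Z v).filter fun z => z ∈ S).card ≤ 2 * c := by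
    intro v hv
    refine (Finset.card_le_card fun z hz => ?_).trans (hlow v hv)
    simp only [hZ, Finset.mem_filter, Finset.mem_univ, true_and] at hz ⊢
    obtain ⟨⟨-, hzv, x, hx, hxz⟩, hzS⟩ := hz
    exact ⟨hzS, hsat v (hIS hv) z hzS hzv.symm x (ReachIn.mono hx subset_rfl (by omega)) hxz⟩
  have hIM : Disjoint I M := Finset.disjoint_left.2 fun v hv hvM => by
    simp [hM] at hvM
    exact hvM.2 (hIS hv)
  -- Separator vertices outside `S` are counted on average, by applying sparsity to a second model:
  -- the sets `T v` together with the singletons of `M`.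
  set B₂ : V → Set V := fun w => if w ∈ I then T w else {w} with hB₂
  have hB₂I : ∀ w ∈ I, B₂ w = T w := fun w hw => by simp [hB₂, hw]
  have hB₂M : ∀ w ∈ M, B₂ w = {w} := fun w hw => by
    simp [hB₂, Finset.disjoint_right.1 hIM hw]
  have hTM : ∀ v ∈ I, ∀ m ∈ M, m ∉ T v := by
    intro v hv m hm hmT
    have hmU : m ∈ U ∧ m ∉ S := by simpa [hM] using hm
    rcases hTsub v hmT with h | h
    · exact h hmU.1
    · rw [Set.mem_singleton_iff] at h
      exact hmU.2 (h ▸ hIS hv)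
  have hmodel : IsBallModel G (2 * r) (I ∪ M) B₂ := by
    refine ⟨fun v hv => ?_, fun u hu v hv huv => ?_, fun v hv x hx => ?_⟩
    · rcases Finset.mem_union.1 hv with h | h
      · rw [hB₂I v h]; exact hself v
      · rw [hB₂M v h]; rfl
    · rcases Finset.mem_union.1 hu with hu | hu <;> rcases Finset.mem_union.1 hv with hv | hv
      · rw [hB₂I u hu, hB₂I v hv]; exact hTdisj u hu v hv huv
      · rw [hB₂I u hu, hB₂M v hv]; simpa using hTM u hu v hv
      · rw [hB₂M u hu, hB₂I v hv]; simpa using hTM v hv u hu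
      · rw [hB₂M u hu, hB₂M v hv]; simpa using huv
    · rcases Finset.mem_union.1 hv with h | h
      · rw [hB₂I v h] at hx ⊢
        exact (ReachIn.inside_basin (ReachIn.symm hx)).symm.mono
          (fun z hz => ReachIn.symm hz) (by omega)
      · rw [hB₂M v h] at hx ⊢
        obtain rfl : x = v := hx
        exact .refl (Set.mem_singleton _) _
  have hcount : ∑ v ∈ I, ((Z v).filter fun z => z ∉ S).card ≤ c * (I ∪ M).card := by
    refine le_trans ?_ (hG _ _ hmodel)
    rw [← Finset.card_sigma]
    refine Finset.card_le_card_of_injOn (fun x => (x.1, x.2)) ?_ ?_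
    · rintro ⟨v, m⟩ h
      simp only [hZ, Finset.coe_sigma, Set.mem_sigma_iff, Finset.mem_coe, Finset.mem_filter,
        Finset.mem_univ, true_and] at h
      obtain ⟨hv, ⟨hmU, hmv, x, hx, hxm⟩, hmS⟩ := h
      have hmM : m ∈ M := by simp [hM, hmU, hmS]
      rw [Finset.mem_coe, mem_touchPairs]
      refine ⟨⟨Finset.mem_union_left _ hv, Finset.mem_union_right _ hmM⟩, hmv.symm, x, ?_, m, ?_,
        hxm⟩
      · rw [hB₂I v hv]; exact hx
      · rw [hB₂M m hmM]; rfl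
    · rintro ⟨a, b⟩ _ ⟨a', b'⟩ _ h
      simp at h
      simp [h.1, h.2]
  have hIne : I.Nonempty := by
    rw [Finset.nonempty_iff_ne_empty]
    rintro rfl
    have := hS.card_pos
    simp at hbig
    simp [hbig] at this
  -- Saturated models are small and `I` is a fixed fraction of `S`, so `M` is linear in `I`.
  have hMcard : M.card ≤ 2 * r * c * (2 * (2 * c + 1)) * I.card := by
    have h1 : M.card = (U \ S).ncard := by rw [hM, Set.ncard_eq_toFinset_card']
    calc M.card ≤ 2 * r * P.card := h1 ▸ hsmall
      _ ≤ 2 * r * (c * (2 * (2 * c + 1) * I.card)) := by gcongr; exact hPc.trans (by gcongr)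
      _ = _ := by ring
  have havg : ∑ v ∈ I, ((Z v).filter fun z => z ∉ S).card ≤
      ∑ v ∈ I, c * (1 + 2 * r * c * (2 * (2 * c + 1))) := by
    rw [Finset.sum_const, smul_eq_mul]
    calc _ ≤ c * (I ∪ M).card := hcount
      _ ≤ c * (I.card + 2 * r * c * (2 * (2 * c + 1)) * I.card) := by
        gcongr
        exact (Finset.card_union_le _ _).trans (by gcongr)
      _ = _ := by ring
  obtain ⟨v, hv, hvle⟩ := Finset.exists_le_of_sum_le hIne havg
  refine ⟨v, hIS hv, Z v, by simp [hZ], ?_, fun u hu huv p hp => ?_⟩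
  · rw [← Finset.card_filter_add_card_filter_not (s := Z v) (fun z => z ∈ S)]
    exact Nat.add_le_add (hZS v hv) hvle
  -- The first vertex of the walk outside `Uᶜ ∪ {v}` lies in `Z v`.
  · obtain ⟨n, y, w, hn, hr, hyw, hw, hwp⟩ := exists_first_exit p
      (show v ∈ Uᶜ ∪ {v} from Or.inr rfl)
      (show u ∉ Uᶜ ∪ {v} by
        rintro (h | h)
        · exact h (hSU u hu)
        · exact huv h)
    refine ⟨w, ?_, hwp⟩
    simp only [Set.mem_union, Set.mem_compl_iff, Set.mem_singleton_iff, not_or, not_not] at hw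
    simp only [hZ, Finset.mem_filter, Finset.mem_univ, true_and]
    exact ⟨hw.1, hw.2, y, hr.mono subset_rfl (by omega), hyw⟩

end Hitting

/-! ### Rankings with bounded weak reachability -/

section WeakReach

variable {V : Type u} {G : SimpleGraph V}

/-- `u` is weakly `n`-reachable from `v` with respect to the ranking `π`: some walk of length at
most `n` from `v` to `u` has `u` as its vertex of smallest rank. -/
def WeakReach (G : SimpleGraph V) (π : V → ℕ) (n : ℕ) (v u : V) : Prop :=
  ReachIn G {z | π u ≤ π z} n v u

/-- Ranks are assigned from the top: the vertex that `h` provides for `S` gets the largest rank, and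
the rest of `S` is ranked recursively. The elements of lower rank are then exactly the others in the
current set, which is what the hitting set handles. -/
theorem exists_ranking_of_hitting_sets [DecidableEq V] {r K : ℕ}
    (h : ∀ S : Finset V, S.Nonempty → ∃ v ∈ S, ∃ Z : Finset V, v ∉ Z ∧ Z.card ≤ K ∧
      ∀ u ∈ S, u ≠ v → ∀ p : G.Walk v u, p.length ≤ r → ∃ z ∈ Z, z ∈ p.support)
    (S : Finset V) :
    ∃ (π : V → ℕ) (Z : V → Finset V), Set.InjOn π S ∧ (∀ v ∈ S, π v < S.card) ∧
      ∀ v ∈ S, v ∉ Z v ∧ (Z v).card ≤ K ∧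
        ∀ u ∈ S, π u < π v → ∀ p : G.Walk v u, p.length ≤ r → ∃ z ∈ Z v, z ∈ p.support := by
  induction S using Finset.strongInduction with
  | H S ih =>
    rcases S.eq_empty_or_nonempty with rfl | hS
    · exact ⟨fun _ => 0, fun _ => ∅, by simp, by simp, by simp⟩
    obtain ⟨v, hv, Y, hvY, hYK, hY⟩ := h S hS
    obtain ⟨π, Z, hinj, hlt, hZ⟩ := ih (S.erase v) (Finset.erase_ssubset hv)
    have hcard : (S.erase v).card + 1 = S.card := Finset.card_erase_add_one hv
    have hother : ∀ u ∈ S, u ≠ v → u ∈ S.erase v := fun u hu huv => Finset.mem_erase.2 ⟨huv, hu⟩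
    refine ⟨Function.update π v (S.erase v).card, Function.update Z v Y, ?_, ?_, ?_⟩
    · intro a ha b hb hab
      by_cases hav : a = v <;> by_cases hbv : b = v
      · rw [hav, hbv]
      · subst hav
        have := hlt b (hother b hb hbv)
        simp [hbv] at hab
        omega
      · subst hbv
        have := hlt a (hother a ha hav)
        simp [hav] at hab
        omega
      · simp [hav, hbv] at hab
        exact hinj (hother a ha hav) (hother b hb hbv) hab
    · intro a ha
      by_cases hav : a = v
      · subst hav; simp; omega
      · have := hlt a (hother a ha hav)
        simp [hav]; omega
    · intro a ha
      by_cases hav : a = v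
      · subst hav
        simp only [Function.update_self]
        refine ⟨hvY, hYK, fun u hu hlt' => hY u hu ?_⟩
        rintro rfl
        simp at hlt'
      · simp only [Function.update_of_ne hav]
        refine ⟨(hZ a (hother a ha hav)).1, (hZ a (hother a ha hav)).2.1, fun u hu hlt' => ?_⟩
        by_cases huv : u = v
        · subst huv
          have := hlt a (hother a ha hav)
          simp at hlt'
          omega
        · rw [Function.update_of_ne huv] at hlt'
          exact (hZ a (hother a ha hav)).2.2 u (hother u hu huv) hlt'

/-- A bound for the number of weakly reachable vertices. -/
def weakBound (K : ℕ) : ℕ → ℕ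
  | 0 => 1
  | n + 1 => 1 + K * weakBound K n

/-- A walk witnessing weak reachability of some `u ≠ v` meets `Z v`. Its remainder from the meeting
point is a shorter witness, so each of the at most `K` points of `Z v` accounts for at most
`weakBound K n` vertices, and `v` itself for one more. -/
theorem ncard_weakReach_le [Finite V] {r K : ℕ} {π : V → ℕ} (hπ : Function.Injective π)
    {Z : V → Finset V}
    (hZ : ∀ v, v ∉ Z v ∧ (Z v).card ≤ K ∧
      ∀ u, π u < π v → ∀ p : G.Walk v u, p.length ≤ r → ∃ z ∈ Z v, z ∈ p.support)
    (n : ℕ) (hn : n ≤ r) (v : V) : {u | WeakReach G π n v u}.ncard ≤ weakBound K n := by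
  classical
  induction n generalizing v with
  | zero =>
    refine (Set.ncard_le_ncard (t := {v}) ?_ (Set.toFinite _)).trans (by simp [weakBound])
    rintro u ⟨p, hp, -⟩
    exact (SimpleGraph.Walk.eq_of_length_eq_zero (Nat.le_zero.1 hp)).symm
  | succ n ih =>
    have hsub : {u | WeakReach G π (n + 1) v u} ⊆
        {v} ∪ ⋃ z ∈ Z v, {u | WeakReach G π n z u} := by
      rintro u ⟨p, hp, hs⟩
      by_cases huv : u = v
      · exact Or.inl huv
      refine Or.inr ?_
      have hlt : π u < π v :=
        lt_of_le_of_ne (hs v p.start_mem_support) fun h => huv (hπ h)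
      obtain ⟨z, hzZ, hz⟩ := (hZ v).2.2 u hlt p (hp.trans hn)
      simp only [Set.mem_iUnion]
      refine ⟨z, hzZ, p.dropUntil z hz, ?_, fun w hw =>
        hs w (p.support_dropUntil_subset_support hz hw)⟩
      have hlen : (p.takeUntil z hz).length + (p.dropUntil z hz).length = p.length := by
        rw [← SimpleGraph.Walk.length_append, SimpleGraph.Walk.take_spec]
      -- Since `v ∉ Z v`, at least one step precedes `z`, and the remaining walk fits the induction
      -- hypothesis.
      have hpos : (p.takeUntil z hz).length ≠ 0 := fun h =>
        (hZ v).1 (by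
          have e := SimpleGraph.Walk.eq_of_length_eq_zero h
          rwa [← e] at hzZ)
      omega
    refine (Set.ncard_le_ncard hsub (Set.toFinite _)).trans ((Set.ncard_union_le _ _).trans ?_)
    rw [Set.ncard_singleton, weakBound]
    gcongr
    refine (Finset.set_ncard_biUnion_le _ _).trans ?_
    refine (Finset.sum_le_card_nsmul _ _ _ fun z _ => ih (by omega) z).trans ?_
    rw [smul_eq_mul]
    gcongr
    exact (hZ v).2.1

/-- Sparse graphs have rankings with few weakly reachable vertices. -/
theorem SparseAt.exists_ranking [Finite V] {r c : ℕ} (hG : SparseAt G (2 * r) c) :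
    ∃ π : V → ℕ, Function.Injective π ∧
      ∀ v, {u | WeakReach G π r v u}.ncard ≤ weakBound (hitBound r c) r := by
  classical
  have := Fintype.ofFinite V
  obtain ⟨π, Z, hinj, -, hZ⟩ := exists_ranking_of_hitting_sets
    (fun S hS => exists_hitting_set (S := S) hG hS) Finset.univ
  have hπ : Function.Injective π := fun a b h => hinj (by simp) (by simp) h
  exact ⟨π, hπ, ncard_weakReach_le hπ (fun v => by simpa using hZ v (by simp)) r le_rfl⟩

end WeakReach

/-! ### From shallow minors to ball models -/

section Nabla

/-- A bound on the densities of shallow minors yields sparsity. -/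
theorem sparseAt_of_nabla_le {G : FinGraph.{u}} {ρ c : ℕ} (h : nabla ρ G ≤ c) :
    SparseAt G.graph ρ (2 * c) := by
  classical
  intro J B hB
  let H : FinGraph.{u} :=
    { V := J
      graph :=
        { Adj := fun a b => a ≠ b ∧ Touch G.graph (B a) (B b)
          symm := ⟨fun a b h => ⟨h.1.symm, h.2.symm⟩⟩
          loopless := ⟨fun _ h => h.1 rfl⟩ } }
  have hminor : IsDepthMinor ρ H G := by
    refine ⟨fun a : J => (⊤ : G.graph.Subgraph).induce (B a), fun a => ?_, fun a b hab => ?_,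
      fun a b hab => hab.2⟩
    · let f : G.graph.induce (B a) →g ((⊤ : G.graph.Subgraph).induce (B a)).coe :=
        { toFun := id
          map_rel' := fun {x y} h => ⟨x.2, y.2, h⟩ }
      let o : ((⊤ : G.graph.Subgraph).induce (B a)).verts := ⟨a.1, hB.mem a.1 a.2⟩
      have hwalk : ∀ y, ∃ p : ((⊤ : G.graph.Subgraph).induce (B a)).coe.Walk o y,
          p.length ≤ ρ := by
        rintro ⟨y, hy⟩
        obtain ⟨p, hp, hs⟩ := hB.reach a.1 a.2 y hy
        have hlen := congrArg SimpleGraph.Walk.length (p.map_induce hs)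
        rw [SimpleGraph.Walk.length_map] at hlen
        exact ⟨(p.induce (B a) hs).map f, by rw [SimpleGraph.Walk.length_map, hlen]; exact hp⟩
      constructor
      · rw [SimpleGraph.connected_iff_exists_forall_reachable]
        exact ⟨o, fun y => ⟨(hwalk y).choose⟩⟩
      · refine SimpleGraph.radius_le_eccent.trans ((SimpleGraph.eccent_le_iff o _).2 fun y => ?_)
        obtain ⟨p, hp⟩ := hwalk y
        exact (SimpleGraph.edist_le p).trans (by exact_mod_cast hp)
    · exact hB.disj a.1 a.2 b.1 b.2 fun h => hab (Subtype.ext h)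
  have hdens : H.edgeDensity ≤ c := le_trans (le_iSup₂_of_le H hminor le_rfl) h
  have hedge : H.graph.edgeSet.ncard ≤ c * J.card := by
    rw [edgeDensity] at hdens
    have hc : Nat.card H.V = J.card := by simp [H]
    -- `J` may be empty; finiteness of `c` replaces a non-zero denominator.
    rw [hc, ENNReal.div_le_iff_le_mul (Or.inr (by simp)) (Or.inl (by simp))] at hdens
    exact_mod_cast hdens
  have : Fintype H.V := Fintype.ofFinite _
  -- Ordered touching pairs correspond to darts, two per edge, whence the factor 2.
  have hdart : (touchPairs G.graph J B).card ≤ Fintype.card H.graph.Dart := by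
    refine Finset.card_le_card_of_surjOn (s := Finset.univ)
      (fun e : H.graph.Dart => ((e.fst : J).1, (e.snd : J).1)) ?_
    rintro ⟨u, v⟩ huv
    obtain ⟨⟨hu, hv⟩, hne, ht⟩ := mem_touchPairs.1 (Finset.mem_coe.1 huv)
    exact ⟨⟨((⟨u, hu⟩ : J), (⟨v, hv⟩ : J)), ⟨fun h => hne (congrArg Subtype.val h), ht⟩⟩,
      by simp, rfl⟩
  have hE : H.graph.edgeFinset.card = H.graph.edgeSet.ncard := by
    rw [Set.ncard_eq_toFinset_card', SimpleGraph.edgeFinset]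
  rw [SimpleGraph.dart_card_eq_twice_card_edges, hE] at hdart
  nlinarith

end Nabla

/-! ### Shallow minors of models with bounded congestion -/

section Congestion

/-- Each edge is charged to an endpoint that is `R`-related to the other one; no vertex is charged
more than `N` times. -/
theorem ncard_edgeSet_le {W : Type u} [Finite W] (H : SimpleGraph W) (R : W → W → Prop) (N : ℕ)
    (hR : ∀ a b, H.Adj a b → R a b ∨ R b a) (hN : ∀ b, {a | R b a}.ncard ≤ N) :
    H.edgeSet.ncard ≤ N * Nat.card W := by
  classical
  have := Fintype.ofFinite W
  have hsub : H.edgeSet ⊆ ⋃ b ∈ (Finset.univ : Finset W), (fun a => s(b, a)) '' {a | R b a} := by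
    intro e
    induction e using Sym2.ind with
    | _ a b =>
      intro h
      simp only [Set.mem_iUnion]
      rcases hR a b h with h | h
      · exact ⟨a, Finset.mem_univ _, b, h, rfl⟩
      · exact ⟨b, Finset.mem_univ _, a, h, Sym2.eq_swap⟩
  refine (Set.ncard_le_ncard hsub (Set.toFinite _)).trans
    ((Finset.set_ncard_biUnion_le _ _).trans ?_)
  refine (Finset.sum_le_card_nsmul _ _ N fun b _ =>
    (Set.ncard_image_le (Set.toFinite _)).trans (hN b)).trans ?_
  rw [smul_eq_mul, Finset.card_univ, Nat.card_eq_fintype_card, mul_comm]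

/-- If the vertices of `Q` are represented in `G` by sets of radius `s`, adjacent vertices by
intersecting or touching sets, and every vertex of `G` belongs to at most `t` of these sets, then
the shallow minors of `Q` are as sparse as the weak reachability in `G` is bounded. -/
theorem nabla_le_of_congestion {G Q : FinGraph.{u}} (S : Q.V → Set G.V) (o : Q.V → G.V)
    {s t r N : ℕ} (hmem : ∀ A, o A ∈ S A)
    (hS : ∀ A, ∀ x ∈ S A, ReachIn G.graph (S A) s x (o A))
    (hadj : ∀ A A', Q.graph.Adj A A' →
      ∃ w ∈ S A, ∃ w' ∈ S A', w = w' ∨ G.graph.Adj w w')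
    (ht : ∀ w, {A | w ∈ S A}.ncard ≤ t) (π : G.V → ℕ)
    (hπ : ∀ v, {u | WeakReach G.graph π (4 * (s + r * (2 * s + 1)) + 1) v u}.ncard ≤ N) :
    nabla r Q ≤ (N * t : ℕ) := by
  classical
  refine iSup₂_le fun K ⟨branch, hconn, hdisj, hKadj⟩ => ?_
  -- From a point to the centre of its set costs `s`; each of at most `r` steps between centres
  -- costs `s + 1 + s`.
  set D := s + r * (2 * s + 1) with hD
  set R : K.V → Set G.V := fun a => {x | ∃ A ∈ (branch a).verts, x ∈ S A} with hR
  have hSR : ∀ a, ∀ A ∈ (branch a).verts, S A ⊆ R a := fun a A hA x hx => ⟨A, hA, hx⟩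
  have hlink : ∀ (X : Set G.V) (w w' : G.V), w ∈ X → w' ∈ X → (w = w' ∨ G.graph.Adj w w') →
      ReachIn G.graph X 1 w w' := by
    rintro X w w' hw hw' (rfl | h)
    · exact .refl hw 1
    · exact .of_adj h hw hw'
  have hchain : ∀ a (A A' : (branch a).verts) (p : (branch a).coe.Walk A A'),
      ReachIn G.graph (R a) (p.length * (2 * s + 1)) (o A) (o A') := by
    intro a A A' p
    induction p with
    | @nil A => exact .refl (hSR a A A.2 (hmem A)) _
    | @cons A A₁ A₂ h q ih =>
      obtain ⟨w, hw, w', hw', hww⟩ := hadj A A₁ ((branch a).adj_sub h)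
      have h1 := (hS A w hw).symm.mono (hSR a A A.2) le_rfl
      have h2 := (hS A₁ w' hw').mono (hSR a A₁ A₁.2) le_rfl
      refine (((h1.trans (hlink (R a) w w' h1.right_mem h2.left_mem hww)).trans h2).trans
        ih).mono subset_rfl ?_
      rw [SimpleGraph.Walk.length_cons]
      ring_nf
      omega
  have hroot : ∀ a, ∃ c : G.V, (R a).Nonempty ∧ ∀ x ∈ R a, ReachIn G.graph (R a) D x c := by
    intro a
    obtain ⟨hc, hr⟩ := hconn a
    have := hc.nonempty
    obtain ⟨O, hO⟩ := SimpleGraph.exists_eccent_eq_radius (G := (branch a).coe)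
    refine ⟨o O, ⟨o O, O, O.2, hmem O⟩, ?_⟩
    rintro x ⟨A, hA, hx⟩
    have hle : (branch a).coe.edist O ⟨A, hA⟩ ≤ r :=
      SimpleGraph.edist_le_eccent.trans (hO.le.trans hr)
    obtain ⟨p, hp⟩ := SimpleGraph.exists_walk_of_edist_ne_top
      (ne_top_of_le_ne_top (ENat.natCast_ne_top r) hle)
    rw [← hp] at hle
    have hlen : p.length ≤ r := by exact_mod_cast hle
    refine (((hS A x hx).mono (hSR a A hA) le_rfl).trans (hchain a _ _ p).symm).mono subset_rfl ?_
    rw [hD]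
    gcongr
  choose c hne hc using hroot
  have hmin : ∀ a, ∃ m ∈ R a, ∀ x ∈ R a, π m ≤ π x := fun a =>
    Set.exists_min_image (R a) π (Set.toFinite _) (hne a)
  choose m hmR hmin using hmin
  choose φ hφ hmφ using hmR
  have hφinj : Function.Injective φ := by
    intro a b hab
    by_contra hne
    exact Set.disjoint_left.1 (hdisj a b hne) (hφ a) (hab ▸ hφ b)
  -- The sets `R a` may overlap, so `m` need not be injective. But `m a` lies in `S (φ a)` and `φ`
  -- is injective, so the congestion bounds the fibres.
  have hfib : ∀ u, {a | m a = u}.ncard ≤ t := by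
    intro u
    refine (Set.ncard_le_ncard_of_injOn φ ?_ hφinj.injOn (Set.toFinite _)).trans (ht u)
    rintro a rfl
    exact hmφ a
  -- Crossing `R a` and `R b` costs `2 * D` each, and the link between them at most one edge.
  have hreach : ∀ a b, K.graph.Adj a b →
      ReachIn G.graph (R a ∪ R b) (4 * D + 1) (m a) (m b) := by
    intro a b hab
    obtain ⟨A, hA, A', hA', hAA⟩ := hKadj a b hab
    obtain ⟨w, hw, w', hw', hww⟩ := hadj A A' hAA
    have key : ∀ e, ∀ x ∈ R e, ∀ y ∈ R e, ReachIn G.graph (R e) (2 * D) x y := fun e x hx y hy =>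
      ((hc e x hx).trans (hc e y hy).symm).mono subset_rfl (by omega)
    have h1 := (key a (m a) ⟨_, hφ a, hmφ a⟩ w ⟨A, hA, hw⟩).mono
      (Set.subset_union_left (t := R b)) le_rfl
    have h2 := (key b w' ⟨A', hA', hw'⟩ (m b) ⟨_, hφ b, hmφ b⟩).mono
      (Set.subset_union_right (s := R a)) le_rfl
    exact ((h1.trans (hlink _ w w' h1.right_mem h2.left_mem hww)).trans h2).mono subset_rfl
      (by omega)
  have hweak : ∀ a b, K.graph.Adj a b → π (m b) ≤ π (m a) →
      WeakReach G.graph π (4 * D + 1) (m a) (m b) := by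
    intro a b hab hle
    refine (hreach a b hab).mono ?_ le_rfl
    rintro z (hz | hz)
    · exact hle.trans (hmin a z hz)
    · exact hmin b z hz
  -- Each edge is charged to the endpoint whose minimum has the larger rank: at most `N` values of
  -- the other minimum, each shared by at most `t` vertices.
  have hedges : K.graph.edgeSet.ncard ≤ N * t * Nat.card K.V := by
    refine ncard_edgeSet_le K.graph
      (fun a b => WeakReach G.graph π (4 * D + 1) (m a) (m b)) _ (fun a b hab => ?_) fun b => ?_
    · rcases le_total (π (m b)) (π (m a)) with h | h
      · exact Or.inl (hweak a b hab h)
      · exact Or.inr (hweak b a hab.symm h)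
    · have := Fintype.ofFinite G.V
      set Y := {u | WeakReach G.graph π (4 * D + 1) (m b) u}.toFinset with hY
      have hsub : {a | WeakReach G.graph π (4 * D + 1) (m b) (m a)} ⊆
          ⋃ u ∈ Y, {a | m a = u} := by
        intro a ha
        simp only [Set.mem_iUnion]
        exact ⟨m a, by rw [hY, Set.mem_toFinset]; exact ha, rfl⟩
      refine (Set.ncard_le_ncard hsub (Set.toFinite _)).trans
        ((Finset.set_ncard_biUnion_le _ _).trans ?_)
      refine (Finset.sum_le_card_nsmul _ _ t fun u _ => hfib u).trans ?_
      rw [smul_eq_mul]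
      gcongr
      rw [hY, ← Set.ncard_eq_toFinset_card']
      exact hπ (m b)
  rw [edgeDensity]
  refine ENNReal.div_le_of_le_mul ?_
  exact_mod_cast hedges

end Congestion

/-! ### Clustering by the least vertex of a ball -/

section Clusters

/-- A walk of length at most `2 * k + 1` has a middle vertex or a middle edge. -/
theorem exists_middle {V : Type u} {G : SimpleGraph V} {k : ℕ} {x y : V} (p : G.Walk x y)
    (hp : p.length ≤ 2 * k + 1) :
    ∃ w w', ReachIn G Set.univ k x w ∧ ReachIn G Set.univ k y w' ∧ (w = w' ∨ G.Adj w w') := by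
  induction k generalizing x y with
  | zero =>
    refine ⟨x, y, .refl (Set.mem_univ _) _, .refl (Set.mem_univ _) _, ?_⟩
    cases p with
    | nil => exact Or.inl rfl
    | cons h q =>
      cases q with
      | nil => exact Or.inr h
      | cons h' q => simp at hp
  | succ k ih =>
    cases p with
    | nil => exact ⟨x, x, .refl (Set.mem_univ _) _, .refl (Set.mem_univ _) _, Or.inl rfl⟩
    | @cons _ b _ h q =>
      rw [SimpleGraph.Walk.length_cons] at hp
      -- The remaining walk is reversed so that its last edge can be stripped too; one edge goes at
      -- each end.
      obtain ⟨q', hq'⟩ : ∃ q' : G.Walk y b, q'.length = q.length :=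
        ⟨q.reverse, q.length_reverse⟩
      cases q' with
      | nil =>
        exact ⟨x, y, .refl (Set.mem_univ _) _, .refl (Set.mem_univ _) _, Or.inr h⟩
      | @cons _ a _ h' q'' =>
        rw [SimpleGraph.Walk.length_cons] at hq'
        obtain ⟨w, w', hw, hw', hww⟩ := ih q''.reverse (by
          rw [SimpleGraph.Walk.length_reverse]; omega)
        have hx := (ReachIn.of_adj h (Set.mem_univ _) (Set.mem_univ _)).trans hw
        have hy := (ReachIn.of_adj h' (Set.mem_univ _) (Set.mem_univ _)).trans hw'
        exact ⟨w, w', hx.mono subset_rfl (by omega), hy.mono subset_rfl (by omega), hww⟩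

/-- The clustering of a power of `G` whose blocks collect the vertices with the same vertex of
smallest rank in their balls. -/
theorem exists_clustering (G : FinGraph.{u}) (d : ℕ) {t : ℕ} (π : G.V → ℕ)
    (ht : ∀ v, {u | WeakReach G.graph π (2 * (d / 2)) v u}.ncard ≤ t) :
    ∃ X : Clustering (G.power d).graph, ∃ (S : X.blocks → Set G.V) (o : X.blocks → G.V),
      (∀ A, o A ∈ S A) ∧ (∀ A, ∀ x ∈ S A, ReachIn G.graph (S A) (2 * (d / 2)) x (o A)) ∧
      (∀ A A', X.quotientGraph.Adj A A' →
        ∃ w ∈ S A, ∃ w' ∈ S A', w = w' ∨ G.graph.Adj w w') ∧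
      ∀ w, {A | w ∈ S A}.ncard ≤ t := by
  classical
  set k := d / 2 with hk
  have hleast : ∀ v, ∃ u, ReachIn G.graph Set.univ k v u ∧
      ∀ w, ReachIn G.graph Set.univ k v w → π u ≤ π w := fun v =>
    Set.exists_min_image {u | ReachIn G.graph Set.univ k v u} π (Set.toFinite _)
      ⟨v, .refl (Set.mem_univ _) _⟩
  choose c hc hmin using hleast
  let X : Clustering (G.power d).graph :=
    { blocks := (Setoid.ker c).classes
      isPartition := Setoid.isPartition_classes _
      isClique := by
        rintro _ ⟨y, rfl⟩ a ha b hb hab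
        have ha : c a = c y := ha
        have hb : c b = c y := hb
        obtain ⟨p, hp, -⟩ := (hc a).trans ((hb.trans ha.symm) ▸ (hc b).symm)
        refine ⟨hab, (SimpleGraph.edist_le p).trans ?_⟩
        have : p.length ≤ d := by omega
        exact_mod_cast this }
  have hrep : ∀ A : X.blocks, ∃ y, ∀ x ∈ A.1, c x = y := by
    rintro ⟨_, y, rfl⟩
    exact ⟨c y, fun x hx => hx⟩
  choose o ho using hrep
  have hblock : ∀ A : X.blocks, A.1 = {x | c x = o A} := by
    intro A
    obtain ⟨y, hy⟩ := A.2
    have hyA : y ∈ A.1 := by rw [hy]; exact rfl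
    rw [← ho A y hyA, hy]
    rfl
  have hinj : Function.Injective o := fun A A' h => Subtype.ext (by
    rw [hblock A, hblock A', h])
  -- The walk from `w` to `x` and on to `c x` stays in the `k`-ball of `x`, where `c x` has least
  -- rank.
  have hball : ∀ x w, ReachIn G.graph Set.univ k x w →
      WeakReach G.graph π (2 * k) w (c x) := by
    intro x w hxw
    have hin : ∀ z, ReachIn G.graph Set.univ k x z →
        ReachIn G.graph {z | π (c x) ≤ π z} k x z := fun z hz =>
      hz.symm.inside_basin.symm.mono (fun y hy => hmin x y (ReachIn.symm hy)) le_rfl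
    exact ((hin w hxw).symm.trans (hin (c x) (hc x))).mono subset_rfl (by omega)
  refine ⟨X, fun A => {w | WeakReach G.graph π (2 * k) w (o A)}, o,
    fun A => ReachIn.refl (A := {z | π (o A) ≤ π z}) (le_refl (π (o A))) _,
    fun A x hx => ReachIn.inside_basin hx, ?_, fun w => ?_⟩
  · rintro A A' ⟨-, x, hx, y, hy, -, hxy⟩
    obtain ⟨p, hp⟩ := SimpleGraph.exists_walk_of_edist_ne_top
      (ne_top_of_le_ne_top (ENat.natCast_ne_top d) hxy)
    rw [← hp] at hxy
    have hlen : p.length ≤ d := by exact_mod_cast hxy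
    -- Rounding in `k = d / 2` is harmless: `d ≤ 2 * k + 1`.
    obtain ⟨w, w', hw, hw', hww⟩ := exists_middle (k := k) p (by omega)
    have hwS := hball x w hw
    have hwS' := hball y w' hw'
    rw [ho A x hx] at hwS
    rw [ho A' y hy] at hwS'
    exact ⟨w, hwS, w', hwS', hww⟩
  · exact (Set.ncard_le_ncard_of_injOn o (fun A hA => hA) hinj.injOn (Set.toFinite _)).trans (ht w)

end Clusters

/-! ### Uniform bounds over a class and the conclusion -/

theorem BoundedExpansion.exists_sparseAt {C : Set FinGraph.{u}} (hC : BoundedExpansion C) (ρ : ℕ) :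
    ∃ c : ℕ, ∀ G ∈ C, SparseAt G.graph ρ c := by
  obtain ⟨n, hn⟩ := ENNReal.exists_nat_gt (hC ρ).ne
  exact ⟨2 * n, fun G hG => sparseAt_of_nabla_le
    ((le_iSup₂ (f := fun G (_ : G ∈ C) => nabla ρ G) G hG).trans hn.le)⟩

/-- Classes of bounded expansion have bounded weak reachability. -/
theorem BoundedExpansion.exists_ranking {C : Set FinGraph.{u}} (hC : BoundedExpansion C) (r : ℕ) :
    ∃ N : ℕ, ∀ G ∈ C, ∃ π : G.V → ℕ, ∀ v, {u | WeakReach G.graph π r v u}.ncard ≤ N := by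
  obtain ⟨c, hc⟩ := hC.exists_sparseAt (2 * r)
  refine ⟨weakBound (hitBound r c) r, fun G hG => ?_⟩
  obtain ⟨π, -, hπ⟩ := (hc G hG).exists_ranking
  exact ⟨π, hπ⟩

end FinGraph

theorem mainTheorem2 (C : Set FinGraph.{u}) (hC : FinGraph.BoundedExpansion C) (d : ℕ) :
    ∃ X : ∀ H : FinGraph.powerClass C d, FinGraph.Clustering (H : FinGraph.{u}).graph,
      FinGraph.BoundedExpansion
        (Set.range fun H : FinGraph.powerClass C d => (H : FinGraph.{u}).quotient (X H)) := by
  choose N hN using fun r => hC.exists_ranking r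
  let s := 2 * (d / 2)
  have key : ∀ H : FinGraph.powerClass C d, ∃ X : FinGraph.Clustering (H : FinGraph.{u}).graph,
      ∀ r, FinGraph.nabla r ((H : FinGraph.{u}).quotient X) ≤
        (N (4 * (s + r * (2 * s + 1)) + 1) * N s : ℕ) := by
    rintro ⟨_, G, hG, rfl⟩
    obtain ⟨π, hπ⟩ := hN s G hG
    obtain ⟨X, S, o, hmem, hS, hadj, ht⟩ := FinGraph.exists_clustering G d π hπ
    refine ⟨X, fun r => ?_⟩
    -- The clustering must not depend on `r`, so it is fixed by `π`; a second ranking, adapted to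
    -- `r`, serves only to count edges of minors.
    obtain ⟨π', hπ'⟩ := hN (4 * (s + r * (2 * s + 1)) + 1) G hG
    exact FinGraph.nabla_le_of_congestion (Q := (G.power d).quotient X) S o hmem hS hadj ht π' hπ'
  choose X hX using key
  refine ⟨X, fun r => lt_of_le_of_lt (iSup₂_le ?_)
    (ENNReal.natCast_lt_top (N (4 * (s + r * (2 * s + 1)) + 1) * N s))⟩
  rintro _ ⟨H, rfl⟩
  exact hX H r
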